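/- Let \(\sigma_1=\begin{pmatrix}0&1\\1&0\end{pmatrix}\), \(\sigma_3=\begin{pmatrix}1&0\\0&-1\end{pmatrix}\), \(B=\tfrac12\sigma_1\), \(C=\tfrac12\sigma_3\), and let \(0<t_f<\pi\). For a measurable control \(s:[0,t_f]\to[0,1]\), let the density matrix \(\rho(t)\) of a spin-\(\tfrac12\) particle evolve by the von Neumann equation \[ \dot\rho=-i\,[\,s(t)B+(1-s(t))C,\ \rho\,],\qquad \rho(0)=\rho_0, \] (in the sense of Carathéodory), where \(\rho_0\) is the ground state of \(B\), i.e. the projector onto a unit eigenvector of \(B\) with the least eigenvalue. Consider the minimization of \(\operatorname{Tr}(\sigma_3\rho(t_f))\) over all such controls. Then: (a) the bang-bang control \(s^*(t)=0\) for \(0\le t<t_f/2\), \(s^*(t)=1\) for \(t_f/2\le t\le t_f\), is optimal; (b) every optimal control equals \(s^*\) for almost every \(t\in[0,t_f]\) (in particular, up to null sets, it has exactly one switch); (c) no optimal control has a singular arc: for every optimal control \(s\) with trajectory \(\rho\), there is a co-state, i.e. a solution \(p\) on \([0,t_f]\) of \(\dot p=-i[\,s(t)B+(1-s(t))C,\,p\,]\)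 with \(p(t_f)=-\sigma_3\), and for every such \(p\) there is no interval \((a,b)\) with \(0\le a<b\le t_f\) such that for all \(t\in(a,b)\) the Pontryagin control Hamiltonian \(v\mapsto \operatorname{Tr}\big(p(t)^\dagger\,(-i)[\,vB+(1-v)C,\ \rho(t)\,]\big)\) is constant on \([0,1]\). -/

import Mathlib

open MeasureTheory Set
open scoped Matrix

noncomputable section

namespace SpinControl

/-- The Pauli matrix `σ₁ = σˣ`. -/
def sigma1 : Matrix (Fin 2) (Fin 2) ℂ := !![0, 1; 1, 0]

/-- The Pauli matrix `σ₃ = σᶻ`. -/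
def sigma3 : Matrix (Fin 2) (Fin 2) ℂ := !![1, 0; 0, -1]

/-- The driver Hamiltonian `B = σˣ / 2` of the spin-1/2 particle. -/
def driver : Matrix (Fin 2) (Fin 2) ℂ := (1 / 2 : ℂ) • sigma1

/-- The target Hamiltonian `C = σᶻ / 2` of the spin-1/2 particle. -/
def target : Matrix (Fin 2) (Fin 2) ℂ := (1 / 2 : ℂ) • sigma3

variable {n : Type*} [Fintype n]

/-- The superoperator `K_X = -i [X, ·]`. -/
def superK (X ρ : Matrix n n ℂ) : Matrix n n ℂ := (-Complex.I) • (X * ρ - ρ * X)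

/-- The right-hand side `K_C ρ + v (K_B ρ - K_C ρ)` of the von Neumann equation at the
control value `v`. -/
def liouvillian (B C : Matrix n n ℂ) (v : ℝ) (ρ : Matrix n n ℂ) : Matrix n n ℂ :=
  superK C ρ + (v : ℂ) • (superK B ρ - superK C ρ)

/-- `ρ` is (the density matrix of) a pure ground state of `H`: it is the projector onto a unit
eigenvector of `H` whose eigenvalue is the least one. -/
def IsGroundState (H ρ : Matrix n n ℂ) : Prop :=
  ∃ (ψ : n → ℂ) (E : ℝ),
    star ψ ⬝ᵥ ψ = 1 ∧
    H *ᵥ ψ = (E : ℂ) • ψ ∧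
    (∀ (φ : n → ℂ) (E' : ℝ), φ ≠ 0 → H *ᵥ φ = (E' : ℂ) • φ → E ≤ E') ∧
    ρ = Matrix.vecMulVec ψ (star ψ)

/-- Admissible controls on `[0, tf]`: measurable schedules with values in `[0, 1]`. -/
def IsAdmissible (tf : ℝ) (s : ℝ → ℝ) : Prop :=
  AEMeasurable s (volume.restrict (Icc 0 tf)) ∧ ∀ t ∈ Icc 0 tf, s t ∈ Icc (0 : ℝ) 1

/-- `X` solves `Ẋ = K_C X + s(t) (K_B X - K_C X)` on `[0, tf]` in the sense of Carathéodory: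
it is continuous and satisfies the equivalent integral equation (entry by entry). -/
def SolvesVonNeumann (B C : Matrix n n ℂ) (tf : ℝ) (s : ℝ → ℝ) (X : ℝ → Matrix n n ℂ) : Prop :=
  ContinuousOn X (Icc 0 tf) ∧
  ∀ t ∈ Icc 0 tf, ∀ i j,
    X t i j = X 0 i j + ∫ u in (0 : ℝ)..t, liouvillian B C (s u) (X u) i j

/-- The expectation value `Tr(M ρ)` (real for Hermitian `M` and `ρ`). -/
def expect (M ρ : Matrix n n ℂ) : ℝ := (M * ρ).trace.re

/-- `(s, ρ)` is an optimal pair for minimizing `Tr(M ρ(tf))` over all admissible controls on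
`[0, tf]`, the state starting from `ρ₀`. -/
def IsOptimalPair (B C M ρ₀ : Matrix n n ℂ) (tf : ℝ) (s : ℝ → ℝ) (ρ : ℝ → Matrix n n ℂ) : Prop :=
  (IsAdmissible tf s ∧ SolvesVonNeumann B C tf s ρ ∧ ρ 0 = ρ₀) ∧
  ∀ (s' : ℝ → ℝ) (ρ' : ℝ → Matrix n n ℂ),
    IsAdmissible tf s' → SolvesVonNeumann B C tf s' ρ' → ρ' 0 = ρ₀ →
      expect M (ρ tf) ≤ expect M (ρ' tf)

/-- The co-state along the control `s` for the cost `Tr(M ρ(tf))`. The generator is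
anti-Hermitian for the Hilbert-Schmidt product, so the adjoint equation `ṗ = -L†p` is the
von Neumann equation itself, with the terminal condition `p(tf) = -M`. -/
def IsCostate (B C M : Matrix n n ℂ) (tf : ℝ) (s : ℝ → ℝ) (p : ℝ → Matrix n n ℂ) : Prop :=
  SolvesVonNeumann B C tf s p ∧ p tf = -M

/-- The Pontryagin control Hamiltonian `⟨p, K_C ρ + v (K_B ρ - K_C ρ)⟩`, with
`⟨X, Y⟩ = Tr(X† Y)` (real for Hermitian `p`, `ρ`, `B` and `C`). -/
def controlHamiltonian (B C p ρ : Matrix n n ℂ) (v : ℝ) : ℝ :=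
  (pᴴ * liouvillian B C v ρ).trace.re

/-- The interval `(a, b)` is a singular arc: the control Hamiltonian along `(p, ρ)` does not
depend on the value of the control there. -/
def IsSingularArc (B C : Matrix n n ℂ) (p ρ : ℝ → Matrix n n ℂ) (a b : ℝ) : Prop :=
  ∀ t ∈ Ioo a b, ∀ v ∈ Icc (0 : ℝ) 1, ∀ w ∈ Icc (0 : ℝ) 1,
    controlHamiltonian B C (p t) (ρ t) v = controlHamiltonian B C (p t) (ρ t) w

/-- The bang-bang schedule `s ≡ 0` on `[0, tf / 2)` and `s ≡ 1` on `[tf / 2, tf]`. -/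
def bangBang (tf : ℝ) (t : ℝ) : ℝ := if t < tf / 2 then 0 else 1

end SpinControl

end

/-!
# Optimality of the bang-bang control of a spin-1/2 particle

Write the propagator as `U = a - i (b σ₁ + c σ₂ + d σ₃)`. Up to a phase the ground state of the
driver is `(1, -1) / √2`, and the upper component of the evolved spinor is `(α + iβ) / √2` with `α = a + c`
and `β = b - d`, so the cost is `α² + β² - 1`. The point is that the real part alone satisfies
`α(T) ≥ cos (T / 2)` for every admissible control. With `γ = b + d`, the variables
`M = (α - iγ) e^{it/2}` and `N = (b + ic) e^{-it/2}` satisfy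
`Ṁ = (1 - s) e^{it} N`, `Ṅ = (s / 2) e^{-it} M`, `M(0) = 1`, `N(0) = 0`. All coefficients have their
arguments in `[0, t]` and `[-t, 0]` respectively, so the Picard iteration preserves the sectors
`arg M ∈ [0, t]` and `arg N ∈ [-t, 0]` (`exists_isRotatingSpinor`). Hence
`α(T) = Re (e^{-iT/2} M(T)) = cos (T / 2) + ∫ (1 - s) Re (e^{i(t - T/2)} N) dt` with a nonnegative
integrand.

Since `T < π`, the factor `Re (e^{i(t - T/2)} N)` is positive as soon as `∫₀ᵗ s > 0`
(`IsRotatingSpinor.integral_le_angComp`). Equality in the bound therefore forces `(1 - s) ∫₀ᵗ s = 0`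
almost everywhere, that is, `s` is a step from `0` to `1` at some time `t₀` (`exists_switch`). Every
such step attains the bound, with `β(T) = sin (T / 2 - t₀)`; minimality of `α² + β²` selects
`t₀ = T / 2` (`IsBloch.eq_bangBang`). The passage between density matrices and spinors goes through
Bloch vectors: the Bloch vector of a density matrix and that of the spinor solve the same linear
equation, whose solutions are unique because lengths are conserved (`IsBloch.eq_of_eq`).

On a singular arc the cross product `m` of the Bloch vectors of state and co-state satisfies
`m₁ = m₃`, because `m₁ - m₃` is twice the slope of the control Hamiltonian. As `m` solves the Bloch
equation itself, differentiating twice gives `m = 0` at some time, hence always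
(`IsBloch.eq_zero_of_singular`). At the final time the co-state is vertical, so the state would be
an eigenstate of `σ₃`, which contradicts the optimal value `cos² (T / 2) - 1 ∈ (-1, 0)`.
-/

namespace SpinControl

/-! ### Absolutely continuous functions -/

/-- `f` is absolutely continuous on `[0, T]` with almost everywhere derivative `f'`. -/
structure IsAC (T : ℝ) (f f' : ℝ → ℝ) : Prop where
  ac : AbsolutelyContinuousOnInterval f 0 T
  deriv : ∀ᵐ t, t ∈ Ioo 0 T → HasDerivAt f (f' t) t

namespace IsAC

variable {T : ℝ} {f f' g g' : ℝ → ℝ}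

lemma add (hf : IsAC T f f') (hg : IsAC T g g') :
    IsAC T (fun t => f t + g t) (fun t => f' t + g' t) :=
  ⟨hf.ac.add hg.ac, by
    filter_upwards [hf.deriv, hg.deriv] with t h1 h2 ht using (h1 ht).add (h2 ht)⟩

lemma sub (hf : IsAC T f f') (hg : IsAC T g g') :
    IsAC T (fun t => f t - g t) (fun t => f' t - g' t) :=
  ⟨hf.ac.sub hg.ac, by
    filter_upwards [hf.deriv, hg.deriv] with t h1 h2 ht using (h1 ht).sub (h2 ht)⟩

lemma mul (hf : IsAC T f f') (hg : IsAC T g g') :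
    IsAC T (fun t => f t * g t) (fun t => f' t * g t + f t * g' t) :=
  ⟨hf.ac.mul hg.ac, by
    filter_upwards [hf.deriv, hg.deriv] with t h1 h2 ht using (h1 ht).mul (h2 ht)⟩

lemma const_mul (c : ℝ) (hf : IsAC T f f') : IsAC T (fun t => c * f t) (fun t => c * f' t) :=
  ⟨hf.ac.const_mul c, by filter_upwards [hf.deriv] with t h1 ht using (h1 ht).const_mul c⟩

lemma congr (hf : IsAC T f f') (h : ∀ t, g t = f t) (h' : ∀ t, g' t = f' t) : IsAC T g g' := by
  rw [show g = f from funext h, show g' = f' from funext h']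
  exact hf

lemma of_contDiff (hf : ContDiff ℝ 1 f) (h : ∀ t, HasDerivAt f (f' t) t) : IsAC T f f' :=
  ⟨hf.contDiffOn.absolutelyContinuousOnInterval, .of_forall fun t _ => h t⟩

lemma of_integral (hT : 0 ≤ T) (hi : IntervalIntegrable f' volume 0 T)
    (h : ∀ t ∈ Icc 0 T, f t = f 0 + ∫ u in (0 : ℝ)..t, f' u) : IsAC T f f' := by
  have hF := hi.absolutelyContinuousOnInterval_intervalIntegral (c := 0) (by simp)
  have hc : AbsolutelyContinuousOnInterval (fun _ : ℝ => f 0) 0 T :=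
    (contDiff_const (n := 1)).contDiffOn.absolutelyContinuousOnInterval
  refine ⟨?_, ?_⟩
  · have h2 := hc.add hF
    have heq : EqOn f ((fun _ : ℝ => f 0) + fun x => ∫ u in (0 : ℝ)..x, f' u) (uIcc 0 T) := by
      intro t ht
      rw [uIcc_of_le hT] at ht
      simpa using h t ht
    rw [absolutelyContinuousOnInterval_iff] at h2 ⊢
    intro ε hε
    obtain ⟨δ, hδ, H⟩ := h2 ε hε
    refine ⟨δ, hδ, fun E hE hE2 => ?_⟩
    refine lt_of_eq_of_lt (Finset.sum_congr rfl fun i hi => ?_) (H E hE hE2)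
    have := hE.1 i (by simpa using hi)
    rw [heq this.1, heq this.2]
  · filter_upwards [hi.ae_hasDerivAt_integral] with t h1 ht
    have h2 := (h1 (by rw [uIcc_of_le hT]; exact Ioo_subset_Icc_self ht) 0
      (by simp)).const_add (f 0)
    refine h2.congr_of_eventuallyEq ?_
    filter_upwards [Ioo_mem_nhds ht.1 ht.2] with u hu
    exact h u (Ioo_subset_Icc_self hu)

lemma eq_of_deriv_eq_zero (hT : 0 ≤ T) (hf : IsAC T f f') (h : ∀ t, f' t = 0) :
    ∀ t ∈ Icc 0 T, f t = f 0 := by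
  obtain ⟨C, hC⟩ := hf.ac.const_of_ae_hasDerivAt_zero (by
    have h0 : ∀ᵐ t : ℝ, t ≠ 0 := by simp [ae_iff]
    have h1 : ∀ᵐ t : ℝ, t ≠ T := by simp [ae_iff]
    filter_upwards [hf.deriv, h0, h1] with t ht h0 h1 hm
    rw [uIcc_of_le hT] at hm
    have := ht ⟨lt_of_le_of_ne hm.1 h0.symm, lt_of_le_of_ne hm.2 h1⟩
    rwa [h t] at this)
  intro t ht
  rw [hC t (by rwa [uIcc_of_le hT]), hC 0 (by simp)]

lemma continuousOn (hT : 0 ≤ T) (hf : IsAC T f f') : ContinuousOn f (Icc 0 T) := by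
  have := hf.ac.continuousOn
  rwa [uIcc_of_le hT] at this

/-- A function that vanishes on an interval has almost everywhere zero derivative there. -/
lemma ae_deriv_eq_zero (hf : IsAC T f f') {a b : ℝ} (ha : 0 ≤ a) (hb : b ≤ T)
    (h : ∀ t ∈ Ioo a b, f t = 0) : ∀ᵐ t, t ∈ Ioo a b → f' t = 0 := by
  filter_upwards [hf.deriv] with t ht hm
  have h1 := ht ⟨ha.trans_lt hm.1, hm.2.trans_le hb⟩
  have h2 : HasDerivAt f 0 t := by
    refine (hasDerivAt_const t (0 : ℝ)).congr_of_eventuallyEq ?_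
    filter_upwards [Ioo_mem_nhds hm.1 hm.2] with u hu using h u hu
  exact h1.unique h2

end IsAC

/-! ### Existence of Carathéodory solutions -/

/-- **Existence of Carathéodory solutions** on `[0, T]` of `ẋ = f(t, x)` with `f` globally
Lipschitz in `x`. If the Picard operator preserves the closed pointwise constraints `x t ∈ S t`,
then the solution satisfies them. The contraction principle is applied on the whole interval at once, in
the exponentially weighted variable `e^{-(K + 1) t} x(t)`. -/
theorem exists_caratheodory_solution {E : Type*} [NormedAddCommGroup E] [NormedSpace ℝ E]
    [CompleteSpace E] {T K : ℝ} (hT : 0 ≤ T) (hK : 0 ≤ K) {f : ℝ → E → E}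
    (hint : ∀ y : ℝ → E, ContinuousOn y (Icc 0 T) →
      IntervalIntegrable (fun u => f u (y u)) volume 0 T)
    (hlip : ∀ u ∈ Icc 0 T, ∀ x y, ‖f u x - f u y‖ ≤ K * ‖x - y‖) (x₀ : E) {S : ℝ → Set E}
    (hSc : ∀ t ∈ Icc 0 T, IsClosed (S t))
    (hSne : ∃ y : ℝ → E, ContinuousOn y (Icc 0 T) ∧ ∀ t ∈ Icc 0 T, y t ∈ S t)
    (hS : ∀ y : ℝ → E, ContinuousOn y (Icc 0 T) → (∀ t ∈ Icc 0 T, y t ∈ S t) →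
      ∀ t ∈ Icc 0 T, x₀ + ∫ u in (0 : ℝ)..t, f u (y u) ∈ S t) :
    ∃ x : ℝ → E, ContinuousOn x (Icc 0 T) ∧
      (∀ t ∈ Icc 0 T, x t = x₀ + ∫ u in (0 : ℝ)..t, f u (x u)) ∧ ∀ t ∈ Icc 0 T, x t ∈ S t := by
  set c := K + 1 with hc
  have hc0 : 0 < c := by positivity
  let ex : C(Icc 0 T, E) → ℝ → E := fun y u => Real.exp (c * u) • IccExtend hT y u
  have hexc : ∀ y, Continuous (ex y) := fun y => by
    have : Continuous (IccExtend hT y) := y.continuous.Icc_extend'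
    exact (by fun_prop : Continuous fun u : ℝ => Real.exp (c * u)).smul this
  have hexI : ∀ y, IntervalIntegrable (fun u => f u (ex y u)) volume 0 T := fun y =>
    hint _ (hexc y).continuousOn
  let pic : C(Icc 0 T, E) → ℝ → E := fun y t => x₀ + ∫ u in (0 : ℝ)..t, f u (ex y u)
  have hpic : ∀ y, ContinuousOn (pic y) (Icc 0 T) := fun y => by
    have := intervalIntegral.continuousOn_primitive_interval'
      (hexI y) (a := 0) (by simp)
    rw [uIcc_of_le hT] at this
    exact continuousOn_const.add this
  let Φ : C(Icc 0 T, E) → C(Icc 0 T, E) := fun y =>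
    ⟨fun t => Real.exp (-(c * t)) • pic y t, by
      have := (hpic y).domRestrict
      have h2 : Continuous fun t : Icc 0 T => Real.exp (-(c * (t : ℝ))) := by fun_prop
      exact h2.smul this⟩
  have hΦ : ∀ y (t : Icc (0 : ℝ) T), Φ y t = Real.exp (-(c * t)) • pic y t := fun y t => rfl
  have hex : ∀ y (t : ℝ) (ht : t ∈ Icc 0 T), ex y t = Real.exp (c * t) • y ⟨t, ht⟩ := by
    intro y t ht
    simp only [ex, IccExtend_of_mem hT y ht]
  let s : Set C(Icc 0 T, E) := {y | ∀ t : Icc (0 : ℝ) T, Real.exp (c * t) • y t ∈ S t}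
  have hs : IsClosed s := by
    have : s = ⋂ t : Icc (0 : ℝ) T, {y | Real.exp (c * t) • y t ∈ S t} := by
      ext y; simp [s]
    rw [this]
    refine isClosed_iInter fun t => (hSc t t.2).preimage ?_
    exact (continuous_eval_const t).const_smul _
  have hmaps : MapsTo Φ s s := by
    intro y hy t
    rw [hΦ, smul_smul, ← Real.exp_add, add_neg_cancel, Real.exp_zero, one_smul]
    exact hS (ex y) (hexc y).continuousOn (fun u hu => by rw [hex y u hu]; exact hy ⟨u, hu⟩) t t.2
  have hcontr : ∀ y z, dist (Φ y) (Φ z) ≤ K / c * dist y z := by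
    intro y z
    rw [ContinuousMap.dist_le (by positivity)]
    intro t
    have ht := t.2
    have hsub : ∀ w, IntervalIntegrable (fun u => f u (ex w u)) volume 0 (t : ℝ) := fun w =>
      (hexI w).mono_set (by rw [uIcc_of_le ht.1, uIcc_of_le hT]; exact Icc_subset_Icc_right ht.2)
    rw [hΦ, hΦ, dist_eq_norm, ← smul_sub, norm_smul, Real.norm_eq_abs, Real.abs_exp,
      show pic y t - pic z t = ∫ u in (0 : ℝ)..t, (f u (ex y u) - f u (ex z u)) by
        rw [intervalIntegral.integral_sub (hsub y) (hsub z)]; simp [pic]]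
    have h1 : ‖∫ u in (0 : ℝ)..t, (f u (ex y u) - f u (ex z u))‖ ≤
        ∫ u in (0 : ℝ)..t, K * dist y z * Real.exp (c * u) := by
      refine intervalIntegral.norm_integral_le_of_norm_le ht.1 (.of_forall fun u hu => ?_)
        (Continuous.intervalIntegrable (by fun_prop) _ _)
      have hu' : u ∈ Icc 0 T := ⟨hu.1.le, hu.2.trans ht.2⟩
      refine (hlip u hu' _ _).trans ?_
      rw [hex y u hu', hex z u hu', ← smul_sub, norm_smul, Real.norm_eq_abs, Real.abs_exp,
        ← dist_eq_norm]
      have := ContinuousMap.dist_apply_le_dist (f := y) (g := z) ⟨u, hu'⟩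
      calc K * (Real.exp (c * u) * dist (y ⟨u, hu'⟩) (z ⟨u, hu'⟩))
          ≤ K * (Real.exp (c * u) * dist y z) := by gcongr
        _ = _ := by ring
    have h2 : ∫ u in (0 : ℝ)..t, K * dist y z * Real.exp (c * u) =
        K * dist y z * ((Real.exp (c * t) - 1) / c) := by
      rw [intervalIntegral.integral_const_mul, intervalIntegral.integral_comp_mul_left _ hc0.ne']
      simp [div_eq_inv_mul]
    calc Real.exp (-(c * t)) * ‖∫ u in (0 : ℝ)..t, (f u (ex y u) - f u (ex z u))‖
        ≤ Real.exp (-(c * t)) * (K * dist y z * (Real.exp (c * t) / c)) := by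
          gcongr
          rw [h2] at h1
          refine h1.trans ?_
          gcongr
          linarith
      _ = (Real.exp (-(c * t)) * Real.exp (c * t)) * (K / c * dist y z) := by ring
      _ = K / c * dist y z := by rw [← Real.exp_add]; simp
  have hK1 : K / c < 1 := by rw [div_lt_one hc0]; linarith
  obtain ⟨w, hwc, hw⟩ := hSne
  let y₀ : C(Icc 0 T, E) := ⟨fun t => Real.exp (-(c * t)) • w t, by
      have h2 : Continuous fun t : Icc 0 T => Real.exp (-(c * (t : ℝ))) := by fun_prop
      exact h2.smul hwc.domRestrict⟩
  have hy₀ : y₀ ∈ s := by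
    intro t
    change Real.exp (c * t) • (Real.exp (-(c * t)) • w t) ∈ S t
    rw [smul_smul, ← Real.exp_add, add_neg_cancel, Real.exp_zero, one_smul]
    exact hw t t.2
  have hcw : ContractingWith ⟨K / c, by positivity⟩ (hmaps.restrict Φ s s) := by
    refine ⟨by exact_mod_cast hK1, LipschitzWith.of_dist_le_mul fun y z => ?_⟩
    exact hcontr y z
  obtain ⟨y, hys, hfix, -⟩ := hcw.exists_fixedPoint' hs.isComplete hmaps hy₀ (edist_ne_top _ _)
  refine ⟨ex y, (hexc y).continuousOn, fun t ht => ?_, fun t ht => ?_⟩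
  · rw [hex y t ht]
    have h1 : Φ y ⟨t, ht⟩ = y ⟨t, ht⟩ := by rw [hfix.eq]
    rw [← h1, hΦ, smul_smul, ← Real.exp_add, add_neg_cancel, Real.exp_zero, one_smul]
  · rw [hex y t ht]
    exact hys ⟨t, ht⟩

/-! ### The spinor in a rotating frame -/

/-- The component of `z` in the direction `e^{iφ}`, that is `Re (e^{-iφ} z)`. -/
noncomputable def angComp (φ : ℝ) : ℂ →L[ℝ] ℝ :=
  Real.cos φ • Complex.reCLM + Real.sin φ • Complex.imCLM

lemma angComp_apply (φ : ℝ) (z : ℂ) : angComp φ z = Real.cos φ * z.re + Real.sin φ * z.im := by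
  simp [angComp]

lemma angComp_exp_mul (φ u : ℝ) (z : ℂ) :
    angComp φ (Complex.exp (u * Complex.I) * z) = angComp (φ - u) z := by
  simp only [angComp_apply, Complex.mul_re, Complex.mul_im, Complex.exp_ofReal_mul_I_re,
    Complex.exp_ofReal_mul_I_im, Real.cos_sub, Real.sin_sub]
  ring

lemma angComp_one (φ : ℝ) : angComp φ 1 = Real.cos φ := by simp [angComp_apply]

lemma IsAdmissible.intervalIntegrable_smul {E : Type*} [NormedAddCommGroup E] [NormedSpace ℝ E]
    {T : ℝ} (hT : 0 ≤ T) {s : ℝ → ℝ} (hs : IsAdmissible T s) {g : ℝ → E}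
    (hg : ContinuousOn g (Icc 0 T)) :
    IntervalIntegrable (fun u => s u • g u) volume 0 T := by
  rw [intervalIntegrable_iff_integrableOn_Icc_of_le hT]
  have hgi : IntegrableOn g (Icc 0 T) := hg.integrableOn_Icc
  refine Integrable.bdd_smul hgi 1 hs.1.aestronglyMeasurable ?_
  filter_upwards [ae_restrict_mem measurableSet_Icc] with t ht
  have := hs.2 t ht
  rw [Real.norm_eq_abs, abs_le]
  exact ⟨by linarith [this.1], this.2⟩

lemma IsAdmissible.intervalIntegrable_mul {T : ℝ} (hT : 0 ≤ T) {s : ℝ → ℝ}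
    (hs : IsAdmissible T s) {g : ℝ → ℝ} (hg : ContinuousOn g (Icc 0 T)) :
    IntervalIntegrable (fun u => s u * g u) volume 0 T :=
  hs.intervalIntegrable_smul hT hg

lemma IsAdmissible.one_sub {T : ℝ} {s : ℝ → ℝ} (hs : IsAdmissible T s) :
    IsAdmissible T (fun t => 1 - s t) :=
  ⟨aemeasurable_const.sub hs.1, fun t ht =>
    ⟨by linarith [(hs.2 t ht).2], by linarith [(hs.2 t ht).1]⟩⟩

/-- The spinor equation in a rotating frame, as integral equations for the components in every
direction `e^{iφ}`: `Ṁ = (1 - s) e^{it} N`, `Ṅ = (s / 2) e^{-it} M`, `M 0 = 1`, `N 0 = 0`. If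
`U = a - i (b σ₁ + c σ₂ + d σ₃)` is the propagator, then `M = (α - iγ) e^{it/2}` and
`N = (b + ic) e^{-it/2}` with `α = a + c` and `γ = b + d`. The last field says, for `t < π`, that
`arg (N t) ∈ [-t, 0]` or `N t = 0`. -/
structure IsRotatingSpinor (T : ℝ) (s : ℝ → ℝ) (M N : ℝ → ℂ) : Prop where
  contM : ContinuousOn M (Icc 0 T)
  contN : ContinuousOn N (Icc 0 T)
  eqM : ∀ φ, ∀ t ∈ Icc 0 T,
    angComp φ (M t) = Real.cos φ + ∫ u in (0 : ℝ)..t, (1 - s u) * angComp (φ - u) (N u)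
  eqN : ∀ φ, ∀ t ∈ Icc 0 T,
    angComp φ (N t) = ∫ u in (0 : ℝ)..t, s u * (angComp (φ + u) (M u) / 2)
  nonnegN : ∀ t ∈ Icc 0 T, ∀ φ ∈ Icc (-(Real.pi / 2)) (Real.pi / 2 - t), 0 ≤ angComp φ (N t)

theorem exists_isRotatingSpinor {T : ℝ} (hT : 0 ≤ T) {s : ℝ → ℝ}
    (hs : IsAdmissible T s) : ∃ M N, IsRotatingSpinor T s M N := by
  let f : ℝ → ℂ × ℂ → ℂ × ℂ := fun u p =>
    ((1 - s u) • (Complex.exp (u * Complex.I) * p.2),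
      s u • ((1 / 2 : ℝ) • (Complex.exp ((-u : ℝ) * Complex.I) * p.1)))
  have he : ∀ g : ℝ → ℝ, Continuous g → Continuous fun u : ℝ => Complex.exp (g u * Complex.I) := by
    intro g hg; fun_prop
  have hint : ∀ y : ℝ → ℂ × ℂ, ContinuousOn y (Icc 0 T) →
      IntervalIntegrable (fun u => f u (y u)) volume 0 T := by
    intro y hy
    have h1 := hs.one_sub.intervalIntegrable_smul hT
      ((he _ continuous_id).continuousOn.mul hy.snd)
    have h2 := hs.intervalIntegrable_smul hT
      (((he _ continuous_neg).continuousOn.mul hy.fst).const_smul (1 / 2 : ℝ))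
    exact ⟨h1.1.prodMk h2.1, h1.2.prodMk h2.2⟩
  have hsub : ∀ y : ℝ → ℂ × ℂ, ContinuousOn y (Icc 0 T) → ∀ t ∈ Icc 0 T,
      IntervalIntegrable (fun u => f u (y u)) volume 0 t := fun y hy t ht =>
    (hint y hy).mono_set (by rw [uIcc_of_le ht.1, uIcc_of_le hT]; exact Icc_subset_Icc_right ht.2)
  have hM : ∀ y : ℝ → ℂ × ℂ, ContinuousOn y (Icc 0 T) → ∀ φ, ∀ t ∈ Icc 0 T,
      angComp φ (((1, 0) : ℂ × ℂ) + ∫ u in (0 : ℝ)..t, f u (y u)).1 =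
        Real.cos φ + ∫ u in (0 : ℝ)..t, (1 - s u) * angComp (φ - u) (y u).2 := by
    intro y hy φ t ht
    have := ((angComp φ).comp (ContinuousLinearMap.fst ℝ ℂ ℂ)).intervalIntegral_comp_comm
      (hsub y hy t ht)
    simp only [ContinuousLinearMap.comp_apply, ContinuousLinearMap.coe_fst', f, map_smul,
      angComp_exp_mul, smul_eq_mul] at this
    rw [this, Prod.fst_add, map_add, angComp_one]
  have hN : ∀ y : ℝ → ℂ × ℂ, ContinuousOn y (Icc 0 T) → ∀ φ, ∀ t ∈ Icc 0 T,
      angComp φ (((1, 0) : ℂ × ℂ) + ∫ u in (0 : ℝ)..t, f u (y u)).2 =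
        ∫ u in (0 : ℝ)..t, s u * (angComp (φ + u) (y u).1 / 2) := by
    intro y hy φ t ht
    have := ((angComp φ).comp (ContinuousLinearMap.snd ℝ ℂ ℂ)).intervalIntegral_comp_comm
      (hsub y hy t ht)
    simp only [ContinuousLinearMap.comp_apply, ContinuousLinearMap.coe_snd', f, map_smul,
      angComp_exp_mul, smul_eq_mul, sub_neg_eq_add] at this
    rw [Prod.snd_add, zero_add, ← this]
    congr 1 with u
    ring
  -- The sectors `arg M ∈ [0, t]` and `arg N ∈ [-t, 0]`, described by supporting half-planes. In
  -- this form they visibly grow with `t`, and the Picard operator preserves them.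
  let S : ℝ → Set (ℂ × ℂ) := fun t =>
    {p | (∀ φ ∈ Icc (t - Real.pi / 2) (Real.pi / 2), 0 ≤ angComp φ p.1) ∧
      ∀ φ ∈ Icc (-(Real.pi / 2)) (Real.pi / 2 - t), 0 ≤ angComp φ p.2}
  have hSc : ∀ t ∈ Icc 0 T, IsClosed (S t) := by
    intro t _
    simp only [S, ofPred_and, ofPred_forall]
    refine IsClosed.inter ?_ ?_ <;>
    · refine isClosed_iInter fun φ => isClosed_iInter fun _ => ?_
      exact isClosed_le continuous_const (by fun_prop)
  have hS : ∀ y : ℝ → ℂ × ℂ, ContinuousOn y (Icc 0 T) → (∀ t ∈ Icc 0 T, y t ∈ S t) →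
      ∀ t ∈ Icc 0 T, ((1, 0) : ℂ × ℂ) + ∫ u in (0 : ℝ)..t, f u (y u) ∈ S t := by
    intro y hy hyS t ht
    have hmem : ∀ u ∈ Icc 0 t, u ∈ Icc 0 T := fun u hu => ⟨hu.1, hu.2.trans ht.2⟩
    refine ⟨fun φ hφ => ?_, fun φ hφ => ?_⟩
    · rw [hM y hy φ t ht]
      refine add_nonneg (Real.cos_nonneg_of_mem_Icc ⟨by linarith [hφ.1, ht.1], hφ.2⟩) ?_
      refine intervalIntegral.integral_nonneg ht.1 fun u hu => ?_
      refine mul_nonneg (by linarith [(hs.2 u (hmem u hu)).2]) ((hyS u (hmem u hu)).2 _ ?_)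
      exact ⟨by linarith [hφ.1, hu.2], by linarith [hφ.2]⟩
    · rw [hN y hy φ t ht]
      refine intervalIntegral.integral_nonneg ht.1 fun u hu => ?_
      refine mul_nonneg (hs.2 u (hmem u hu)).1 (div_nonneg ((hyS u (hmem u hu)).1 _ ?_) zero_le_two)
      exact ⟨by linarith [hφ.1], by linarith [hφ.2, hu.2]⟩
  obtain ⟨x, hxc, hx, hxS⟩ := exists_caratheodory_solution hT zero_le_one hint
    (fun u hu x y => by
      have h := hs.2 u hu
      have e : f u x - f u y = f u (x - y) := by
        simp only [f, Prod.mk_sub_mk, Prod.fst_sub, Prod.snd_sub, mul_sub, smul_sub]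
      rw [e, one_mul]
      refine max_le ?_ ?_
      · have h1 : ‖1 - s u‖ ≤ 1 := by
          rw [Real.norm_eq_abs, abs_le]; constructor <;> linarith [h.1, h.2]
        simp only [f, norm_smul, norm_mul, Complex.norm_exp_ofReal_mul_I, one_mul]
        nlinarith [norm_snd_le (x - y), norm_nonneg (x - y).2]
      · have h1 : ‖s u‖ ≤ 1 := by
          rw [Real.norm_eq_abs, abs_le]; constructor <;> linarith [h.1, h.2]
        have h2 : ‖(1 / 2 : ℝ)‖ = 1 / 2 := by norm_num
        simp only [f, norm_smul, norm_mul, Complex.norm_exp_ofReal_mul_I, one_mul, h2]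
        nlinarith [norm_fst_le (x - y), norm_nonneg (x - y).1, norm_nonneg (s u)])
    ((1, 0) : ℂ × ℂ) hSc
    ⟨0, continuousOn_const, fun t _ => by simp [S]⟩ hS
  refine ⟨fun t => (x t).1, fun t => (x t).2, hxc.fst, hxc.snd, fun φ t ht => ?_, fun φ t ht => ?_,
    fun t ht => (hxS t ht).2⟩
  · rw [hx t ht, hM x hxc φ t ht]
  · rw [hx t ht, hN x hxc φ t ht]

variable {T : ℝ} {s : ℝ → ℝ} {M N : ℝ → ℂ}

namespace IsRotatingSpinor

lemma intervalIntegrableM (h : IsRotatingSpinor T s M N) (hT : 0 ≤ T) (hs : IsAdmissible T s)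
    (φ : ℝ) : IntervalIntegrable (fun u => (1 - s u) * angComp (φ - u) (N u)) volume 0 T := by
  refine hs.one_sub.intervalIntegrable_mul hT ?_
  simp only [angComp_apply]
  have h1 := Complex.continuous_re.comp_continuousOn h.contN
  have h2 := Complex.continuous_im.comp_continuousOn h.contN
  exact ((by fun_prop : Continuous fun u => Real.cos (φ - u)).continuousOn.mul h1).add
    ((by fun_prop : Continuous fun u => Real.sin (φ - u)).continuousOn.mul h2)

lemma intervalIntegrableN (h : IsRotatingSpinor T s M N) (hT : 0 ≤ T) (hs : IsAdmissible T s)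
    (φ : ℝ) : IntervalIntegrable (fun u => s u * (angComp (φ + u) (M u) / 2)) volume 0 T := by
  refine hs.intervalIntegrable_mul hT ?_
  simp only [angComp_apply]
  have h1 := Complex.continuous_re.comp_continuousOn h.contM
  have h2 := Complex.continuous_im.comp_continuousOn h.contM
  exact (((by fun_prop : Continuous fun u => Real.cos (φ + u)).continuousOn.mul h1).add
    ((by fun_prop : Continuous fun u => Real.sin (φ + u)).continuousOn.mul h2)).div_const 2

/-- The sector condition on `Ṁ = (1 - s) e^{it} N` keeps `M` ahead of its initial value in
every supporting direction. -/
lemma cos_le_angComp (h : IsRotatingSpinor T s M N) (hs : IsAdmissible T s) {t φ : ℝ}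
    (ht : t ∈ Icc 0 T) (hφ : φ ∈ Icc (t - Real.pi / 2) (Real.pi / 2)) :
    Real.cos φ ≤ angComp φ (M t) := by
  rw [h.eqM φ t ht]
  refine le_add_of_nonneg_right (intervalIntegral.integral_nonneg ht.1 fun u hu => ?_)
  have hu' : u ∈ Icc 0 T := ⟨hu.1, hu.2.trans ht.2⟩
  refine mul_nonneg (by linarith [(hs.2 u hu').2]) (h.nonnegN u hu' _ ?_)
  exact ⟨by linarith [hφ.1, hu.2], by linarith [hφ.2]⟩

/-- The component of `N` that drives `α` is positive as soon as the control has acted. -/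
lemma integral_le_angComp (h : IsRotatingSpinor T s M N) (hT : 0 ≤ T) (hTπ : T < Real.pi)
    (hs : IsAdmissible T s) {t : ℝ} (ht : t ∈ Icc 0 T) :
    Real.cos (T / 2) / 2 * ∫ u in (0 : ℝ)..t, s u ≤ angComp (T / 2 - t) (N t) := by
  have hsub : uIcc 0 t ⊆ uIcc 0 T := by
    rw [uIcc_of_le ht.1, uIcc_of_le hT]; exact Icc_subset_Icc_right ht.2
  rw [h.eqN _ t ht, ← intervalIntegral.integral_const_mul]
  refine intervalIntegral.integral_mono_on ht.1 ?_
    ((h.intervalIntegrableN hT hs _).mono_set hsub) fun u hu => ?_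
  · have := hs.intervalIntegrable_mul hT (continuousOn_const (c := (1 : ℝ)))
    simp only [mul_one] at this
    exact (this.mono_set hsub).const_mul _
  · have hu' : u ∈ Icc 0 T := ⟨hu.1, hu.2.trans ht.2⟩
    have h1 : Real.cos (T / 2 - t + u) ≤ angComp (T / 2 - t + u) (M u) :=
      h.cos_le_angComp hs hu' ⟨by linarith [ht.2], by linarith [hu.2]⟩
    have h2 : Real.cos (T / 2) ≤ Real.cos (T / 2 - t + u) := by
      rw [← Real.cos_abs (T / 2 - t + u)]
      refine Real.cos_le_cos_of_nonneg_of_le_pi (abs_nonneg _) (by linarith) ?_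
      rw [abs_le]
      constructor <;> linarith [hu.1, hu.2, ht.1, ht.2]
    have h3 := (hs.2 u hu').1
    nlinarith

/-- The amplitude bound `α T ≥ cos (T / 2)` behind the optimality of the bang-bang control. Every
step control attains it. -/
lemma cos_half_le (h : IsRotatingSpinor T s M N) (hT : 0 ≤ T) (hTπ : T < Real.pi)
    (hs : IsAdmissible T s) : Real.cos (T / 2) ≤ angComp (T / 2) (M T) :=
  h.cos_le_angComp hs ⟨hT, le_rfl⟩ ⟨by linarith, by linarith⟩

/-- A control that attains the amplitude bound equals `1` once it has acted at all. -/
lemma ae_mul_integral_eq_zero (h : IsRotatingSpinor T s M N) (hT : 0 ≤ T) (hTπ : T < Real.pi)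
    (hs : IsAdmissible T s) (heq : angComp (T / 2) (M T) ≤ Real.cos (T / 2)) :
    ∀ᵐ t ∂volume.restrict (Icc 0 T), (1 - s t) * ∫ u in (0 : ℝ)..t, s u = 0 := by
  have hcos : 0 < Real.cos (T / 2) :=
    Real.cos_pos_of_mem_Ioo ⟨by linarith [Real.pi_pos], by linarith⟩
  have hSnn : ∀ t ∈ Icc 0 T, 0 ≤ ∫ u in (0 : ℝ)..t, s u := fun t ht =>
    intervalIntegral.integral_nonneg ht.1 fun u hu => (hs.2 u ⟨hu.1, hu.2.trans ht.2⟩).1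
  have hnn : ∀ t ∈ Icc 0 T, 0 ≤ (1 - s t) * angComp (T / 2 - t) (N t) := fun t ht =>
    mul_nonneg (by linarith [(hs.2 t ht).2]) (h.nonnegN t ht _
      ⟨by linarith [ht.2], by linarith [ht.2]⟩)
  have h0 : ∫ u in (0 : ℝ)..T, (1 - s u) * angComp (T / 2 - u) (N u) = 0 := by
    have := h.eqM (T / 2) T ⟨hT, le_rfl⟩
    have h2 := intervalIntegral.integral_nonneg (μ := volume) hT hnn
    linarith
  rw [intervalIntegral.integral_of_le hT, ← integral_Icc_eq_integral_Ioc,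
    setIntegral_eq_zero_iff_of_nonneg_ae] at h0
  · filter_upwards [h0, ae_restrict_mem measurableSet_Icc] with t h1 ht
    have h2 := h.integral_le_angComp hT hTπ hs ht
    rcases mul_eq_zero.1 h1 with h3 | h3
    · rw [h3, zero_mul]
    · have h4 := hSnn t ht
      have : ∫ u in (0 : ℝ)..t, s u = 0 := by
        refine le_antisymm ?_ h4
        rw [h3] at h2
        by_contra! hcon
        nlinarith [mul_pos hcos hcon]
      rw [this, mul_zero]
  · filter_upwards [ae_restrict_mem measurableSet_Icc] with t ht using hnn t ht
  · rw [← intervalIntegrable_iff_integrableOn_Icc_of_le hT]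
    exact h.intervalIntegrableM hT hs _

end IsRotatingSpinor

/-- A control that equals `1` once it has acted at all is a single step. -/
lemma exists_switch (hT : 0 ≤ T) (hs : IsAdmissible T s)
    (h : ∀ᵐ t ∂volume.restrict (Icc 0 T), (1 - s t) * ∫ u in (0 : ℝ)..t, s u = 0) :
    ∃ t₀ ∈ Icc 0 T, ∀ᵐ t ∂volume.restrict (Icc 0 T), s t = if t < t₀ then 0 else 1 := by
  have hsi : IntervalIntegrable s volume 0 T := by
    have := hs.intervalIntegrable_mul hT (continuousOn_const (c := (1 : ℝ)))
    simpa only [mul_one] using this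
  have hc : ContinuousOn (fun t => ∫ u in (0 : ℝ)..t, s u) (Icc 0 T) := by
    have := intervalIntegral.continuousOn_primitive_interval' hsi (a := 0) (by simp)
    rwa [uIcc_of_le hT] at this
  set A := Icc 0 T ∩ (fun t => ∫ u in (0 : ℝ)..t, s u) ⁻¹' {0} with hA
  have hAc : IsClosed A := hc.preimage_isClosed_of_isClosed isClosed_Icc isClosed_singleton
  have hAb : BddAbove A := ⟨T, fun t ht => ht.1.2⟩
  have hmem : sSup A ∈ A := hAc.csSup_mem ⟨0, ⟨le_rfl, hT⟩, by simp⟩ hAb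
  set t₀ := sSup A
  have h0 : ∫ u in (0 : ℝ)..t₀, s u = 0 := hmem.2
  have hle : Icc 0 t₀ ⊆ Icc 0 T := Icc_subset_Icc_right hmem.1.2
  rw [intervalIntegral.integral_of_le hmem.1.1, ← integral_Icc_eq_integral_Ioc,
    setIntegral_eq_zero_iff_of_nonneg_ae] at h0
  · refine ⟨t₀, hmem.1, ?_⟩
    have h0' := (ae_restrict_iff' measurableSet_Icc).1 h0
    have hne : ∀ᵐ t : ℝ, t ≠ t₀ := by simp [ae_iff]
    filter_upwards [h, ae_restrict_mem measurableSet_Icc, ae_restrict_of_ae h0',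
      ae_restrict_of_ae hne] with t h1 ht h2 h3
    split_ifs with hlt
    · exact h2 ⟨ht.1, hlt.le⟩
    · rcases mul_eq_zero.1 h1 with h4 | h4
      · linarith
      · exact absurd (le_antisymm (le_csSup hAb ⟨ht, h4⟩) (not_lt.1 hlt)) h3
  · filter_upwards [ae_restrict_mem measurableSet_Icc] with t ht using (hs.2 t (hle ht)).1
  · exact ((intervalIntegrable_iff_integrableOn_Icc_of_le hT).1 hsi).mono_set hle

namespace IsRotatingSpinor

/-- For a step control the spinor equation is solved explicitly. -/
lemma angComp_of_step (h : IsRotatingSpinor T s M N) (hT : 0 ≤ T) {t₀ : ℝ} (ht₀ : t₀ ∈ Icc 0 T)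
    (hstep : ∀ᵐ t ∂volume.restrict (Icc 0 T), s t = if t < t₀ then 0 else 1) (φ : ℝ) :
    angComp φ (M T) = Real.cos φ ∧
      angComp φ (N T) = (Real.sin (φ + T) - Real.sin (φ + t₀)) / 2 := by
  have hst := (ae_restrict_iff' measurableSet_Icc).1 hstep
  have hN : ∀ t ∈ Icc 0 T, t ≤ t₀ → ∀ φ, angComp φ (N t) = 0 := by
    intro t ht htt φ
    rw [h.eqN φ t ht, intervalIntegral.integral_of_le ht.1]
    refine setIntegral_eq_zero_of_ae_eq_zero ?_
    have hne : ∀ᵐ t : ℝ, t ≠ t₀ := by simp [ae_iff]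
    filter_upwards [hst, hne] with u hu hu2 hum
    rw [hu ⟨hum.1.le, hum.2.trans ht.2⟩, if_pos (lt_of_le_of_ne (hum.2.trans htt) hu2), zero_mul]
  have hM : ∀ t ∈ Icc 0 T, ∀ φ, angComp φ (M t) = Real.cos φ := by
    intro t ht φ
    rw [h.eqM φ t ht, intervalIntegral.integral_of_le ht.1, add_eq_left]
    refine setIntegral_eq_zero_of_ae_eq_zero ?_
    filter_upwards [hst] with u hu hum
    have hu' : u ∈ Icc 0 T := ⟨hum.1.le, hum.2.trans ht.2⟩
    rw [hu hu']
    split_ifs with hlt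
    · rw [hN u hu' hlt.le, mul_zero]
    · simp
  refine ⟨hM T ⟨hT, le_rfl⟩ φ, ?_⟩
  have key : ∫ u in (0 : ℝ)..T, s u * (angComp (φ + u) (M u) / 2) =
      ∫ u in (0 : ℝ)..T, (Ici t₀).indicator (fun u => Real.cos (φ + u) / 2) u := by
    rw [intervalIntegral.integral_of_le hT, intervalIntegral.integral_of_le hT]
    refine setIntegral_congr_ae measurableSet_Ioc ?_
    filter_upwards [hst] with u hu hum
    have hu' : u ∈ Icc 0 T := ⟨hum.1.le, hum.2⟩
    rw [hu hu', hM u hu', indicator_apply]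
    by_cases hlt : u < t₀ <;> simp [hlt, not_le.2, not_lt.1]
  rw [h.eqN φ T ⟨hT, le_rfl⟩, key, intervalIntegral.integral_of_le hT,
    ← integral_Icc_eq_integral_Ioc, setIntegral_indicator measurableSet_Ici,
    show Icc 0 T ∩ Ici t₀ = Icc t₀ T by
      ext u; simp only [mem_inter_iff, mem_Icc, mem_Ici]
      exact ⟨fun h => ⟨h.2, h.1.2⟩, fun h => ⟨⟨ht₀.1.trans h.1, h.2⟩, h.1⟩⟩,
    integral_Icc_eq_integral_Ioc, ← intervalIntegral.integral_of_le ht₀.2,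
    intervalIntegral.integral_div, intervalIntegral.integral_comp_add_left (fun u => Real.cos u),
    integral_cos]

end IsRotatingSpinor

/-! ### Bloch vectors -/

/-- `(x, y, z)` solves the Bloch equation `ṙ = Ω × r` with `Ω = (s, 0, 1 - s)`. -/
structure IsBloch (T : ℝ) (s x y z : ℝ → ℝ) : Prop where
  dx : IsAC T x (fun t => -((1 - s t) * y t))
  dy : IsAC T y (fun t => (1 - s t) * x t - s t * z t)
  dz : IsAC T z (fun t => s t * y t)

namespace IsBloch

variable {T : ℝ} {s x y z x' y' z' : ℝ → ℝ}

lemma sub (h : IsBloch T s x y z) (h' : IsBloch T s x' y' z') :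
    IsBloch T s (fun t => x t - x' t) (fun t => y t - y' t) (fun t => z t - z' t) :=
  ⟨(h.dx.sub h'.dx).congr (fun _ => rfl) (fun t => by ring),
    (h.dy.sub h'.dy).congr (fun _ => rfl) (fun t => by ring),
    (h.dz.sub h'.dz).congr (fun _ => rfl) (fun t => by ring)⟩

lemma normSq_eq (h : IsBloch T s x y z) (hT : 0 ≤ T) {t : ℝ} (ht : t ∈ Icc 0 T) :
    x t ^ 2 + y t ^ 2 + z t ^ 2 = x 0 ^ 2 + y 0 ^ 2 + z 0 ^ 2 := by
  have := (((h.dx.mul h.dx).add (h.dy.mul h.dy)).add (h.dz.mul h.dz)).eq_of_deriv_eq_zero hT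
    (fun t => by ring) t ht
  linarith

/-- The Bloch equation has at most one solution through a given point, because the length of the
difference of two solutions is conserved. -/
lemma eq_of_eq (h : IsBloch T s x y z) (h' : IsBloch T s x' y' z') (hT : 0 ≤ T) (hx : x 0 = x' 0)
    (hy : y 0 = y' 0) (hz : z 0 = z' 0) {t : ℝ} (ht : t ∈ Icc 0 T) :
    x t = x' t ∧ y t = y' t ∧ z t = z' t := by
  have := (h.sub h').normSq_eq hT ht
  simp only [hx, hy, hz, sub_self] at this
  refine ⟨?_, ?_, ?_⟩ <;> rw [← sub_eq_zero, ← sq_eq_zero_iff] <;>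
  nlinarith [sq_nonneg (x t - x' t), sq_nonneg (y t - y' t), sq_nonneg (z t - z' t)]

/-- The cross product of two Bloch vectors evolves like a Bloch vector. -/
lemma cross (h : IsBloch T s x y z) (h' : IsBloch T s x' y' z') :
    IsBloch T s (fun t => y t * z' t - z t * y' t) (fun t => z t * x' t - x t * z' t)
      (fun t => x t * y' t - y t * x' t) :=
  ⟨((h.dy.mul h'.dz).sub (h.dz.mul h'.dy)).congr (fun _ => rfl) (fun t => by ring),
    ((h.dz.mul h'.dx).sub (h.dx.mul h'.dz)).congr (fun _ => rfl) (fun t => by ring),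
    ((h.dx.mul h'.dy).sub (h.dy.mul h'.dx)).congr (fun _ => rfl) (fun t => by ring)⟩

end IsBloch

/-- The spinor equation `U̇ = -i (s B + (1 - s) C) U` in real coordinates: for the propagator
`U = a - i (b σ₁ + c σ₂ + d σ₃)`, put `α = a + c` and `γ = b + d`. -/
structure IsSpinor (T : ℝ) (s α γ b c : ℝ → ℝ) : Prop where
  dα : IsAC T α (fun t => (1 - s t) * b t - γ t / 2)
  dγ : IsAC T γ (fun t => -((1 - s t) * c t) + α t / 2)
  db : IsAC T b (fun t => s t * α t / 2 - c t / 2)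
  dc : IsAC T c (fun t => -(s t * γ t / 2) + b t / 2)

lemma IsRotatingSpinor.isSpinor {T : ℝ} {s : ℝ → ℝ} {M N : ℝ → ℂ}
    (h : IsRotatingSpinor T s M N) (hT : 0 ≤ T) (hs : IsAdmissible T s) :
    IsSpinor T s (fun t => angComp (t / 2) (M t)) (fun t => -angComp (t / 2 + Real.pi / 2) (M t))
      (fun t => angComp (-(t / 2)) (N t)) (fun t => angComp (-(t / 2) + Real.pi / 2) (N t)) := by
  have h0 : (0 : ℝ) ∈ Icc 0 T := ⟨le_rfl, hT⟩
  have hM : ∀ φ, IsAC T (fun t => angComp φ (M t)) (fun t => (1 - s t) * angComp (φ - t) (N t)) :=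
    fun φ => IsAC.of_integral hT (h.intervalIntegrableM hT hs φ) fun t ht => by
      rw [h.eqM φ t ht, h.eqM φ 0 h0]; simp
  have hN : ∀ φ, IsAC T (fun t => angComp φ (N t)) (fun t => s t * (angComp (φ + t) (M t) / 2)) :=
    fun φ => IsAC.of_integral hT (h.intervalIntegrableN hT hs φ) fun t ht => by
      rw [h.eqN φ t ht, h.eqN φ 0 h0]; simp
  have hC : IsAC T (fun t => Real.cos (t / 2)) (fun t => -Real.sin (t / 2) / 2) :=
    .of_contDiff (by fun_prop) fun t => by
      have := ((hasDerivAt_id' t).div_const 2).cos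
      convert! this using 1; ring
  have hS : IsAC T (fun t => Real.sin (t / 2)) (fun t => Real.cos (t / 2) / 2) :=
    .of_contDiff (by fun_prop) fun t => by
      have := ((hasDerivAt_id' t).div_const 2).sin
      convert! this using 1; ring
  have e1 : ∀ t, Real.cos t * Real.cos (t / 2) + Real.sin t * Real.sin (t / 2) = Real.cos (t / 2) :=
    fun t => by rw [← Real.cos_sub]; ring_nf
  have e2 : ∀ t, Real.sin t * Real.cos (t / 2) - Real.cos t * Real.sin (t / 2) = Real.sin (t / 2) :=
    fun t => by rw [← Real.sin_sub]; ring_nf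
  have hM1 := hM 0
  have hM2 := hM (Real.pi / 2)
  have hN1 := hN 0
  have hN2 := hN (Real.pi / 2)
  simp only [angComp_apply, Real.cos_zero,
    Real.sin_zero, Real.cos_pi_div_two, Real.sin_pi_div_two, Real.cos_sub, Real.sin_sub,
    Real.cos_add, Real.sin_add, Real.cos_neg, Real.sin_neg, zero_mul, one_mul, add_zero, zero_add,
    mul_zero, mul_one, sub_zero, zero_sub] at *
  constructor
  · refine ((hC.mul hM1).add (hS.mul hM2)).congr (fun _ => rfl) fun t => ?_
    linear_combination (-(1 - s t) * (N t).re) * e1 t + ((1 - s t) * (N t).im) * e2 t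
  · refine ((hS.mul hM1).sub (hC.mul hM2)).congr (fun _ => by ring) fun t => ?_
    linear_combination ((1 - s t) * (N t).im) * e1 t + ((1 - s t) * (N t).re) * e2 t
  · refine ((hC.mul hN1).sub (hS.mul hN2)).congr (fun _ => by ring) fun t => ?_
    linear_combination (-(s t) * (M t).re / 2) * e1 t - (s t * (M t).im / 2) * e2 t
  · refine ((hS.mul hN1).add (hC.mul hN2)).congr (fun _ => by ring) fun t => ?_
    linear_combination (-(s t) * (M t).im / 2) * e1 t + (s t * (M t).re / 2) * e2 t

/-- With `β = b - d = 2 b - γ` and `δ = a - c = α - 2 c`, the propagator maps `(1, -1) / √2` to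
`(α + iβ, -δ - iγ) / √2`. The Bloch vector of this spinor solves the Bloch equation. -/
lemma IsSpinor.isBloch {T : ℝ} {s α γ b c : ℝ → ℝ} (h : IsSpinor T s α γ b c) :
    IsBloch T s
      (fun t => -(α t * (α t - 2 * c t)) - (2 * b t - γ t) * γ t)
      (fun t => -(α t * γ t) + (2 * b t - γ t) * (α t - 2 * c t))
      (fun t => (α t * α t + (2 * b t - γ t) * (2 * b t - γ t) - γ t * γ t
        - (α t - 2 * c t) * (α t - 2 * c t)) / 2) := by
  have hβ := (h.db.const_mul 2).sub h.dγ
  have hδ := h.dα.sub (h.dc.const_mul 2)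
  refine ⟨?_, ?_, ?_⟩
  · exact (((h.dα.mul hδ).const_mul (-1)).sub (hβ.mul h.dγ)).congr (fun _ => by ring)
      (fun t => by ring)
  · exact ((hβ.mul hδ).sub (h.dα.mul h.dγ)).congr (fun _ => by ring) (fun t => by ring)
  · exact (((((h.dα.mul h.dα).add (hβ.mul hβ)).sub (h.dγ.mul h.dγ)).sub (hδ.mul hδ)).const_mul
      (1 / 2)).congr (fun _ => by ring) (fun t => by ring)

/-- Conservation of the norm `α² + β² + γ² + δ²`. -/
lemma IsSpinor.normSq_eq {T : ℝ} {s α γ b c : ℝ → ℝ} (h : IsSpinor T s α γ b c) (hT : 0 ≤ T)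
    {t : ℝ} (ht : t ∈ Icc 0 T) :
    α t ^ 2 + (2 * b t - γ t) ^ 2 + γ t ^ 2 + (α t - 2 * c t) ^ 2 =
      α 0 ^ 2 + (2 * b 0 - γ 0) ^ 2 + γ 0 ^ 2 + (α 0 - 2 * c 0) ^ 2 := by
  have hβ := (h.db.const_mul 2).sub h.dγ
  have hδ := h.dα.sub (h.dc.const_mul 2)
  have := ((((h.dα.mul h.dα).add (hβ.mul hβ)).add (h.dγ.mul h.dγ)).add
    (hδ.mul hδ)).eq_of_deriv_eq_zero hT (fun t => by ring) t ht
  linarith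

/-! ### The optimal control problem for Bloch vectors -/

section

variable {T : ℝ} {s x y z : ℝ → ℝ}

/-- The final height of the Bloch vector is `α² + β² - 1`, here with `α` and `β = 2 b - γ` in terms
of the rotating spinor. -/
lemma IsRotatingSpinor.final_height {M N : ℝ → ℂ} (h : IsRotatingSpinor T s M N) (hT : 0 ≤ T)
    (hs : IsAdmissible T s) (hr : IsBloch T s x y z) (hx : x 0 = -1) (hy : y 0 = 0)
    (hz : z 0 = 0) :
    z T = angComp (T / 2) (M T) ^ 2 +
      (2 * angComp (-(T / 2)) (N T) + angComp (T / 2 + Real.pi / 2) (M T)) ^ 2 - 1 := by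
  have hsp := h.isSpinor hT hs
  have h0 : (0 : ℝ) ∈ Icc 0 T := ⟨le_rfl, hT⟩
  have hTT : T ∈ Icc 0 T := ⟨hT, le_rfl⟩
  have hα : angComp (0 / 2) (M 0) = 1 := by rw [h.eqM _ 0 h0]; simp
  have hγ : angComp (0 / 2 + Real.pi / 2) (M 0) = 0 := by rw [h.eqM _ 0 h0]; simp
  have hb : angComp (-(0 / 2)) (N 0) = 0 := by rw [h.eqN _ 0 h0]; simp
  have hc : angComp (-(0 / 2) + Real.pi / 2) (N 0) = 0 := by rw [h.eqN _ 0 h0]; simp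
  have h1 := hsp.normSq_eq hT hTT
  have h2 := (hr.eq_of_eq hsp.isBloch hT (by simp only [hα, hγ, hb, hc, hx]; ring)
    (by simp only [hα, hγ, hb, hc, hy]; ring) (by simp only [hα, hγ, hb, hc, hz]; ring) hTT).2.2
  simp only [hα, hγ, hb, hc] at h1
  rw [h2]
  linarith

/-- No admissible control brings the Bloch vector below the height `cos² (T / 2) - 1`. -/
theorem IsBloch.le_final_height (hr : IsBloch T s x y z) (hT : 0 ≤ T) (hTπ : T < Real.pi)
    (hs : IsAdmissible T s) (hx : x 0 = -1) (hy : y 0 = 0) (hz : z 0 = 0) :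
    Real.cos (T / 2) ^ 2 - 1 ≤ z T := by
  obtain ⟨M, N, h⟩ := exists_isRotatingSpinor hT hs
  have hcos : 0 < Real.cos (T / 2) :=
    Real.cos_pos_of_mem_Ioo ⟨by linarith [Real.pi_pos], by linarith⟩
  rw [h.final_height hT hs hr hx hy hz]
  nlinarith [h.cos_half_le hT hTπ hs, sq_nonneg
    (2 * angComp (-(T / 2)) (N T) + angComp (T / 2 + Real.pi / 2) (M T))]

/-- For a step at time `t₀` the second component `β` of the final amplitude is
`sin (T / 2 - t₀)`. -/
lemma IsRotatingSpinor.transverse_of_step {M N : ℝ → ℂ} (h : IsRotatingSpinor T s M N)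
    (hT : 0 ≤ T) {t₀ : ℝ} (ht₀ : t₀ ∈ Icc 0 T)
    (hstep : ∀ᵐ t ∂volume.restrict (Icc 0 T), s t = if t < t₀ then 0 else 1) :
    2 * angComp (-(T / 2)) (N T) + angComp (T / 2 + Real.pi / 2) (M T) =
      Real.sin (T / 2 - t₀) := by
  rw [(h.angComp_of_step hT ht₀ hstep _).1, (h.angComp_of_step hT ht₀ hstep _).2,
    Real.cos_add_pi_div_two, show -(T / 2) + T = T / 2 by ring,
    show -(T / 2) + t₀ = -(T / 2 - t₀) by ring, Real.sin_neg]
  ring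

theorem IsBloch.final_height_bangBang (hr : IsBloch T s x y z) (hT : 0 ≤ T)
    (hs : IsAdmissible T s) (hx : x 0 = -1) (hy : y 0 = 0) (hz : z 0 = 0)
    (hstep : ∀ᵐ t ∂volume.restrict (Icc 0 T), s t = bangBang T t) :
    z T = Real.cos (T / 2) ^ 2 - 1 := by
  obtain ⟨M, N, h⟩ := exists_isRotatingSpinor hT hs
  have ht₀ : T / 2 ∈ Icc 0 T := ⟨by linarith, by linarith⟩
  rw [h.final_height hT hs hr hx hy hz, h.transverse_of_step hT ht₀ hstep,
    (h.angComp_of_step hT ht₀ hstep _).1, sub_self, Real.sin_zero]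
  ring

/-- A control that reaches the height `cos² (T / 2) - 1` attains the bound on `α`, so it is a step;
and `β = sin (T / 2 - t₀)` vanishes, so the step is at `t₀ = T / 2`. -/
theorem IsBloch.eq_bangBang (hr : IsBloch T s x y z) (hT : 0 ≤ T) (hTπ : T < Real.pi)
    (hs : IsAdmissible T s) (hx : x 0 = -1) (hy : y 0 = 0) (hz : z 0 = 0)
    (hopt : z T ≤ Real.cos (T / 2) ^ 2 - 1) :
    ∀ᵐ t ∂volume.restrict (Icc 0 T), s t = bangBang T t := by
  obtain ⟨M, N, h⟩ := exists_isRotatingSpinor hT hs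
  have hcos : 0 < Real.cos (T / 2) :=
    Real.cos_pos_of_mem_Ioo ⟨by linarith [Real.pi_pos], by linarith⟩
  have hle := h.cos_half_le hT hTπ hs
  rw [h.final_height hT hs hr hx hy hz] at hopt
  have hα : angComp (T / 2) (M T) ≤ Real.cos (T / 2) := by
    nlinarith [sq_nonneg
      (2 * angComp (-(T / 2)) (N T) + angComp (T / 2 + Real.pi / 2) (M T))]
  obtain ⟨t₀, ht₀, hstep⟩ := exists_switch hT hs (h.ae_mul_integral_eq_zero hT hTπ hs hα)
  rw [h.transverse_of_step hT ht₀ hstep, le_antisymm hα hle] at hopt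
  have hsin : Real.sin (T / 2 - t₀) = 0 := by
    rw [← sq_eq_zero_iff]; nlinarith [sq_nonneg (Real.sin (T / 2 - t₀))]
  have := (Real.sin_eq_zero_iff_of_lt_of_lt (by linarith [ht₀.2]) (by linarith [ht₀.1])).1 hsin
  have ht : t₀ = T / 2 := by linarith
  subst ht
  exact hstep

end

/-- Let `m` solve the Bloch equation for the bang-bang control. If `m₁ - m₃` vanishes on an
interval, then so does its derivative `-m₂`, hence also `m₂' = (1 - 2 s) m₁` with `|1 - 2 s| = 1`.
As the length of `m` is conserved, `m` vanishes identically. -/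
theorem IsBloch.eq_zero_of_singular {T : ℝ} {s m₁ m₂ m₃ : ℝ → ℝ} (h : IsBloch T s m₁ m₂ m₃)
    (hT : 0 ≤ T) (hs : ∀ᵐ t ∂volume.restrict (Icc 0 T), s t = bangBang T t) {a b : ℝ}
    (ha : 0 ≤ a) (hab : a < b) (hb : b ≤ T) (hsing : ∀ t ∈ Ioo a b, m₁ t - m₃ t = 0) :
    ∀ t ∈ Icc 0 T, m₁ t = 0 ∧ m₂ t = 0 ∧ m₃ t = 0 := by
  have hsub : Ioo a b ⊆ Icc 0 T := fun t ht => ⟨ha.trans ht.1.le, ht.2.le.trans hb⟩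
  have hst := (ae_restrict_iff' measurableSet_Icc).1 hs
  have h1 := (h.dx.sub h.dz).ae_deriv_eq_zero ha hb hsing
  have h2 : ∀ᵐ t, t ∈ Ioo a b → m₂ t = 0 := by
    filter_upwards [h1] with t ht hm
    linarith [ht hm]
  have h2' : EqOn m₂ 0 (Ioo a b) := by
    refine MeasureTheory.Measure.eqOn_Ioo_of_ae_eq volume
      ((ae_restrict_iff' measurableSet_Ioo).2 h2)
      ((h.dy.continuousOn hT).mono hsub) continuousOn_const
  have h3 := h.dy.ae_deriv_eq_zero ha hb fun t ht => h2' ht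
  obtain ⟨t₁, ht₁, hz⟩ : ∃ t ∈ Ioo a b, m₁ t = 0 := by
    have hne : Filter.NeBot (ae (volume.restrict (Ioo a b))) := by
      rw [ae_neBot, Ne, Measure.restrict_eq_zero]
      simp [hab]
    have : ∀ᵐ t ∂volume.restrict (Ioo a b), t ∈ Ioo a b ∧ m₁ t = 0 := by
      rw [ae_restrict_iff' measurableSet_Ioo]
      filter_upwards [h3, hst] with t h3 hst hm
      refine ⟨hm, ?_⟩
      have e1 := h3 hm
      have e2 := hsing t hm
      have e3 : m₃ t = m₁ t := by linarith
      rw [hst (hsub hm), bangBang, e3] at e1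
      split_ifs at e1 <;> linarith
    exact this.exists
  intro t ht
  have e0 := h.normSq_eq hT (hsub ht₁)
  have e1 := h.normSq_eq hT ht
  have e3 : m₃ t₁ = 0 := by linarith [hsing t₁ ht₁]
  have e2 : m₂ t₁ = 0 := h2' ht₁
  rw [hz, e2, e3] at e0
  refine ⟨?_, ?_, ?_⟩ <;> rw [← sq_eq_zero_iff] <;>
  nlinarith [sq_nonneg (m₁ t), sq_nonneg (m₂ t), sq_nonneg (m₃ t)]

/-! ### Solutions of the von Neumann equation -/

section Existence

variable {n : Type*} [Fintype n] {T : ℝ} {s : ℝ → ℝ}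

theorem exists_linear_control_solution {E : Type*} [NormedAddCommGroup E] [NormedSpace ℝ E]
    [CompleteSpace E] (hT : 0 ≤ T) (hs : IsAdmissible T s) (P Q : E →L[ℝ] E) (x₀ : E) :
    ∃ x : ℝ → E, ContinuousOn x (Icc 0 T) ∧
      IntervalIntegrable (fun u => P (x u) + s u • Q (x u)) volume 0 T ∧
      ∀ t ∈ Icc 0 T, x t = x₀ + ∫ u in (0 : ℝ)..t, (P (x u) + s u • Q (x u)) := by
  have hint : ∀ y : ℝ → E, ContinuousOn y (Icc 0 T) →
      IntervalIntegrable (fun u => P (y u) + s u • Q (y u)) volume 0 T := fun y hy => by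
    refine IntervalIntegrable.add ?_
      (hs.intervalIntegrable_smul hT (Q.continuous.comp_continuousOn hy))
    refine ContinuousOn.intervalIntegrable ?_
    rw [uIcc_of_le hT]
    exact P.continuous.comp_continuousOn hy
  obtain ⟨x, hxc, hx, -⟩ := exists_caratheodory_solution (f := fun u x => P x + s u • Q x)
    (S := fun _ => univ) hT
    (by positivity : 0 ≤ ‖P‖ + ‖Q‖) hint (fun u hu x y => by
      have e : P x + s u • Q x - (P y + s u • Q y) = P (x - y) + s u • Q (x - y) := by
        simp only [map_sub, smul_sub]; abel
      have h1 : ‖s u‖ ≤ 1 := by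
        rw [Real.norm_eq_abs, abs_le]
        constructor <;> linarith [(hs.2 u hu).1, (hs.2 u hu).2]
      rw [e, add_mul]
      refine (norm_add_le _ _).trans (add_le_add (P.le_opNorm _) ?_)
      rw [norm_smul]
      exact (mul_le_of_le_one_left (norm_nonneg _) h1).trans (Q.le_opNorm _)) x₀
    (fun _ _ => isClosed_univ) ⟨0, continuousOn_const, fun _ _ => mem_univ _⟩
    (fun _ _ _ _ _ => mem_univ _)
  exact ⟨x, hxc, hint x hxc, hx⟩

lemma superK_add (H X Y : Matrix n n ℂ) : superK H (X + Y) = superK H X + superK H Y := by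
  simp only [superK, Matrix.mul_add, Matrix.add_mul, ← smul_add]
  congr 1
  abel

lemma superK_smul (H : Matrix n n ℂ) (c : ℝ) (X : Matrix n n ℂ) :
    superK H (c • X) = c • superK H X := by
  simp only [superK, Matrix.mul_smul, Matrix.smul_mul, ← smul_sub]
  rw [smul_comm]

/-- The superoperator `superK H`, as a continuous linear map on the normed space `n → n → ℂ`
(matrices carry no global norm). -/
noncomputable def superKCLM (H : Matrix n n ℂ) : (n → n → ℂ) →L[ℝ] (n → n → ℂ) :=
  LinearMap.toContinuousLinearMap
    { toFun := fun X => superK H (X : Matrix n n ℂ)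
      map_add' := fun X Y => superK_add H X Y
      map_smul' := fun c X => superK_smul H c X }

lemma liouvillian_apply_apply (B C : Matrix n n ℂ) (v : ℝ) (X : Matrix n n ℂ) (i j : n) :
    liouvillian B C v X i j = superK C X i j + v • (superK B X - superK C X) i j := by
  simp [liouvillian]

lemma continuousOn_apply_apply {n : Type*} {Y : ℝ → Matrix n n ℂ} {S : Set ℝ}
    (hY : ContinuousOn Y S) (i j : n) : ContinuousOn (fun t => Y t i j) S :=
  (Continuous.matrix_elem continuous_id i j).comp_continuousOn hY

lemma IsAdmissible.intervalIntegrable_liouvillian {X : ℝ → Matrix n n ℂ} (B C : Matrix n n ℂ)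
    (hT : 0 ≤ T) (hs : IsAdmissible T s) (hX : ContinuousOn X (Icc 0 T)) (i j : n) :
    IntervalIntegrable (fun u => liouvillian B C (s u) (X u) i j) volume 0 T := by
  have hK : ∀ H : Matrix n n ℂ, ContinuousOn (fun t => superK H (X t)) (Icc 0 T) := fun H =>
    (superKCLM H).continuous.comp_continuousOn hX
  simp only [liouvillian_apply_apply]
  refine IntervalIntegrable.add (ContinuousOn.intervalIntegrable ?_)
    (hs.intervalIntegrable_smul hT (continuousOn_apply_apply ((hK B).sub (hK C)) i j))
  rw [uIcc_of_le hT]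
  exact continuousOn_apply_apply (hK C) i j

/-- Solutions of `Ẋ = ε (K_C X + s(t) (K_B X - K_C X))`. The sign `ε = 1` gives the von Neumann
equation and `ε = -1` its time reversal. -/
lemma exists_liouvillian_solution (B C : Matrix n n ℂ) (hT : 0 ≤ T) (hs : IsAdmissible T s)
    (ε : ℝ) (X₀ : Matrix n n ℂ) :
    ∃ X : ℝ → Matrix n n ℂ, ContinuousOn X (Icc 0 T) ∧ X 0 = X₀ ∧
      ∀ t ∈ Icc 0 T, ∀ i j,
        X t i j = X₀ i j + ε • ∫ u in (0 : ℝ)..t, liouvillian B C (s u) (X u) i j := by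
  obtain ⟨X, hc, hi, hX⟩ := exists_linear_control_solution hT hs (ε • superKCLM C)
    (ε • (superKCLM B - superKCLM C)) (fun i j => X₀ i j)
  refine ⟨X, hc, ?_, fun t ht i j => ?_⟩
  · have := hX 0 ⟨le_rfl, hT⟩
    rw [intervalIntegral.integral_same, add_zero] at this
    exact this
  · have h1 := ((ContinuousLinearMap.proj (R := ℝ) (φ := fun _ : n => ℂ) j).comp
      (ContinuousLinearMap.proj (R := ℝ) (φ := fun _ : n => n → ℂ) i)).intervalIntegral_comp_comm
      (hi.mono_set (c := 0) (d := t) (by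
        rw [uIcc_of_le hT, uIcc_of_le ht.1]; exact Icc_subset_Icc_right ht.2))
    have h2 := congrFun (congrFun (hX t ht) i) j
    have h3 : ∀ u, ((ContinuousLinearMap.proj (R := ℝ) (φ := fun _ : n => ℂ) j).comp
        (ContinuousLinearMap.proj (R := ℝ) (φ := fun _ : n => n → ℂ) i))
          ((ε • superKCLM C) (X u) + s u • (ε • (superKCLM B - superKCLM C)) (X u)) =
        ε • liouvillian B C (s u) (X u) i j := fun u => by
      have h4 : ∀ a b : ℂ, ε • a + s u • (ε • b) = ε • (a + s u • b) := fun a b => by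
        rw [smul_add, smul_comm ε (s u)]
      exact (h4 _ _).trans (congrArg (ε • ·) (liouvillian_apply_apply B C (s u) (X u) i j).symm)
    simp only [h3] at h1
    rw [← intervalIntegral.integral_smul, h1]
    exact h2

theorem exists_solvesVonNeumann (B C : Matrix n n ℂ) (hT : 0 ≤ T) (hs : IsAdmissible T s)
    (X₀ : Matrix n n ℂ) : ∃ X, SolvesVonNeumann B C T s X ∧ X 0 = X₀ := by
  obtain ⟨X, hc, h0, hX⟩ := exists_liouvillian_solution B C hT hs 1 X₀
  refine ⟨X, ⟨hc, fun t ht i j => ?_⟩, h0⟩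
  rw [hX t ht, h0, one_smul]

lemma IsAdmissible.reverse (hs : IsAdmissible T s) : IsAdmissible T (fun t => s (T - t)) := by
  refine ⟨?_, fun t ht => hs.2 _ ⟨by linarith [ht.2], by linarith [ht.1]⟩⟩
  have hmp := (Measure.measurePreserving_sub_left volume T).restrict_preimage
    (measurableSet_Icc (a := (0 : ℝ)) (b := T))
  have hpre : (fun t => T - t) ⁻¹' Icc 0 T = Icc 0 T := by simp
  rw [hpre] at hmp
  exact hs.1.comp_quasiMeasurePreserving hmp.quasiMeasurePreserving

/-- The co-state exists along every admissible control: it is obtained by time reversal. -/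
theorem exists_isCostate (B C M : Matrix n n ℂ) (hT : 0 ≤ T) (hs : IsAdmissible T s) :
    ∃ p, IsCostate B C M T s p := by
  obtain ⟨q, hc, h0, hq⟩ := exists_liouvillian_solution B C hT hs.reverse (-1) (-M)
  have hi := hs.reverse.intervalIntegrable_liouvillian B C hT hc
  have hmaps : MapsTo (fun t => T - t) (Icc 0 T) (Icc 0 T) := fun t ht =>
    ⟨by linarith [ht.2], by linarith [ht.1]⟩
  refine ⟨fun t => q (T - t), ⟨hc.comp (by fun_prop) hmaps, fun t ht i j => ?_⟩, by simpa using h0⟩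
  have e : ∫ u in (0 : ℝ)..t, liouvillian B C (s u) (q (T - u)) i j =
      ∫ u in (T - t)..T, liouvillian B C (s (T - u)) (q u) i j := by
    have := intervalIntegral.integral_comp_sub_left (a := 0) (b := t)
      (fun u => liouvillian B C (s (T - u)) (q u) i j) T
    simpa using this
  have hsub := intervalIntegral.integral_interval_sub_left (hi i j)
    ((hi i j).mono_set (c := 0) (d := T - t) (by
      rw [uIcc_of_le hT, uIcc_of_le (hmaps ht).1]; exact Icc_subset_Icc_right (hmaps ht).2))
  change q (T - t) i j = q (T - 0) i j + _
  rw [e, ← hsub, sub_zero, hq _ (hmaps ht), hq T ⟨hT, le_rfl⟩]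
  simp only [neg_smul, one_smul]
  ring

end Existence

/-! ### Bloch vectors of solutions -/

section Bloch

variable {T : ℝ} {s : ℝ → ℝ} {X : ℝ → Matrix (Fin 2) (Fin 2) ℂ}

/-- Linear functionals of a solution satisfy the equation almost everywhere. -/
lemma SolvesVonNeumann.isAC {n : Type*} [Fintype n] {B C : Matrix n n ℂ} {X : ℝ → Matrix n n ℂ}
    (h : SolvesVonNeumann B C T s X) (hT : 0 ≤ T) (hs : IsAdmissible T s) (k : n → n → ℂ) :
    IsAC T (fun t => (∑ i, ∑ j, k i j * X t i j).re)
      (fun t => (∑ i, ∑ j, k i j * liouvillian B C (s t) (X t) i j).re) := by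
  have hi := hs.intervalIntegrable_liouvillian B C hT h.1
  have hi2 : IntervalIntegrable
      (fun u => ∑ i, ∑ j, k i j * liouvillian B C (s u) (X u) i j) volume 0 T := by
    have := IntervalIntegrable.sum (μ := volume) (a := 0) (b := T) Finset.univ fun i _ =>
      IntervalIntegrable.sum Finset.univ fun j _ => (hi i j).const_mul (k i j)
    refine this.congr fun u _ => ?_
    simp
  have hsub : ∀ t ∈ Icc 0 T, uIcc 0 t ⊆ uIcc 0 T := fun t ht => by
    rw [uIcc_of_le ht.1, uIcc_of_le hT]; exact Icc_subset_Icc_right ht.2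
  refine IsAC.of_integral hT ⟨hi2.1.re, hi2.2.re⟩ fun t ht => ?_
  have e1 := Complex.reCLM.intervalIntegral_comp_comm (hi2.mono_set (hsub t ht))
  simp only [Complex.reCLM_apply] at e1
  rw [e1, ← Complex.add_re, intervalIntegral.integral_finsetSum, ← Finset.sum_add_distrib]
  · congr 1
    refine Finset.sum_congr rfl fun i _ => ?_
    rw [intervalIntegral.integral_finsetSum, ← Finset.sum_add_distrib]
    · refine Finset.sum_congr rfl fun j _ => ?_
      rw [intervalIntegral.integral_const_mul, ← mul_add, ← h.2 t ht i j]
    · exact fun j _ => ((hi i j).mono_set (hsub t ht)).const_mul _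
  · intro i _
    have := IntervalIntegrable.sum (μ := volume) (a := 0) (b := t) Finset.univ fun j _ =>
      ((hi i j).mono_set (hsub t ht)).const_mul (k i j)
    refine this.congr fun u _ => ?_
    simp

/-- The entries of the generator for the spin-1/2 particle. -/
lemma liouvillian_driver_target (v : ℝ) (Y : Matrix (Fin 2) (Fin 2) ℂ) :
    liouvillian driver target v Y =
      !![-Complex.I * (v / 2) * (Y 1 0 - Y 0 1),
        -Complex.I * ((1 - v) * Y 0 1 + v / 2 * (Y 1 1 - Y 0 0));
        -Complex.I * (-(1 - v) * Y 1 0 + v / 2 * (Y 0 0 - Y 1 1)),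
        -Complex.I * (v / 2) * (Y 0 1 - Y 1 0)] := by
  ext i j
  fin_cases i <;> fin_cases j <;>
  · simp [liouvillian, superK, driver, target, sigma1, sigma3, Matrix.mul_apply, Matrix.vecMul,
      dotProduct]
    ring

/-- The coefficients `Tr (σ_k X)` of `X` along the Pauli matrices, indexed from `0`. They are
complex; for Hermitian `X` they are real and form its Bloch vector. -/
noncomputable def pauliCoeff (X : Matrix (Fin 2) (Fin 2) ℂ) : Fin 3 → ℂ :=
  ![X 0 1 + X 1 0, Complex.I * (X 0 1 - X 1 0), X 0 0 - X 1 1]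

/-- The real parts of the Pauli coefficients of `c X` solve the Bloch equation. The phases `c = 1`
and `c = -i` select the Hermitian and the anti-Hermitian part of a solution `X`. -/
lemma SolvesVonNeumann.isBloch (h : SolvesVonNeumann driver target T s X) (hT : 0 ≤ T)
    (hs : IsAdmissible T s) (c : ℂ) :
    IsBloch T s (fun t => (c * pauliCoeff (X t) 0).re) (fun t => (c * pauliCoeff (X t) 1).re)
      (fun t => (c * pauliCoeff (X t) 2).re) := by
  have hre : ∀ (v : ℝ) (w : ℂ), v * w.re = (v * w).re := fun v w => by simp
  have hI := Complex.I_mul_I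
  refine ⟨?_, ?_, ?_⟩
  · refine (h.isAC hT hs !![0, c; c, 0]).congr (fun t => ?_) fun t => ?_
    · simp [pauliCoeff, Fin.sum_univ_two]; ring
    · rw [← neg_mul, show -(1 - s t) = ((s t - 1 : ℝ)) by ring, hre]
      congr 1
      simp [pauliCoeff, Fin.sum_univ_two, liouvillian_driver_target]
      ring
  · refine (h.isAC hT hs !![0, c * Complex.I; -(c * Complex.I), 0]).congr (fun t => ?_) fun t => ?_
    · congr 1
      simp [pauliCoeff, Fin.sum_univ_two]; ring
    · rw [hre, hre, ← Complex.sub_re]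
      congr 1
      simp [pauliCoeff, Fin.sum_univ_two, liouvillian_driver_target]
      linear_combination (c * ((1 - s t) * (X t 0 1 + X t 1 0) + s t * (X t 1 1 - X t 0 0))) * hI
  · refine (h.isAC hT hs !![c, 0; 0, -c]).congr (fun t => ?_) fun t => ?_
    · congr 1
      simp [pauliCoeff, Fin.sum_univ_two]; ring
    · rw [hre]
      congr 1
      simp [pauliCoeff, Fin.sum_univ_two, liouvillian_driver_target]
      ring

lemma SolvesVonNeumann.isBloch_re (h : SolvesVonNeumann driver target T s X) (hT : 0 ≤ T)
    (hs : IsAdmissible T s) :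
    IsBloch T s (fun t => (pauliCoeff (X t) 0).re) (fun t => (pauliCoeff (X t) 1).re)
      (fun t => (pauliCoeff (X t) 2).re) := by
  simpa using h.isBloch hT hs 1

lemma SolvesVonNeumann.isBloch_im (h : SolvesVonNeumann driver target T s X) (hT : 0 ≤ T)
    (hs : IsAdmissible T s) :
    IsBloch T s (fun t => (pauliCoeff (X t) 0).im) (fun t => (pauliCoeff (X t) 1).im)
      (fun t => (pauliCoeff (X t) 2).im) := by
  simpa using h.isBloch hT hs (-Complex.I)

lemma expect_sigma3 (ρ : Matrix (Fin 2) (Fin 2) ℂ) : expect sigma3 ρ = (pauliCoeff ρ 2).re := by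
  simp [expect, sigma3, pauliCoeff, Matrix.trace, Fin.sum_univ_two, Matrix.vecMul, dotProduct]
  ring

/-- For Hermitian `ρ`, the slope of the control Hamiltonian is half the difference of the first and
third components of the cross product of the Bloch vectors of state and co-state. -/
lemma controlHamiltonian_slope (p ρ : Matrix (Fin 2) (Fin 2) ℂ)
    (h : ∀ k, (pauliCoeff ρ k).im = 0) :
    controlHamiltonian driver target p ρ 1 - controlHamiltonian driver target p ρ 0 =
      ((((pauliCoeff ρ 1).re * (pauliCoeff p 2).re - (pauliCoeff ρ 2).re * (pauliCoeff p 1).re)) -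
      ((pauliCoeff ρ 0).re * (pauliCoeff p 1).re - (pauliCoeff ρ 1).re * (pauliCoeff p 0).re))
        / 2 := by
  have h0 := h 0
  have h1 := h 1
  have h2 := h 2
  simp [pauliCoeff] at h0 h1 h2
  simp [controlHamiltonian, liouvillian_driver_target, pauliCoeff, Matrix.trace, Fin.sum_univ_two,
    Matrix.mul_apply]
  rw [show (ρ 1 0).im = -(ρ 0 1).im by linarith, show (ρ 1 0).re = (ρ 0 1).re by linarith,
    show (ρ 1 1).im = (ρ 0 0).im by linarith]
  ring

/-- The ground state of the driver is the projector onto `(1, -1) / √2`. -/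
lemma IsGroundState.driver_eq {ρ : Matrix (Fin 2) (Fin 2) ℂ} (h : IsGroundState driver ρ) :
    ρ = !![1 / 2, -(1 / 2); -(1 / 2), 1 / 2] := by
  obtain ⟨ψ, E, hn, he, hmin, rfl⟩ := h
  have hE : E ≤ -(1 / 2) := by
    refine hmin ![1, -1] (-(1 / 2)) (fun h0 => by simpa using congrFun h0 0) ?_
    ext i
    fin_cases i <;> simp [driver, sigma1, Matrix.mulVec, dotProduct, Fin.sum_univ_two]
  have e0 := congrFun he 0
  have e1 := congrFun he 1
  simp [driver, sigma1, Matrix.mulVec, dotProduct, Fin.sum_univ_two] at e0 e1 hn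
  -- Every eigenvalue is `± 1 / 2`, and the vector `(1, -1)` shows that `E ≤ -1 / 2`.
  have h1 : ψ 1 = 2 * E * ψ 0 := by linear_combination 2 * e0
  have h0 : ψ 0 ≠ 0 := fun h0 => by simp [h1, h0] at hn
  have hE2 : (1 - 4 * E ^ 2 : ℝ) = 0 := by
    have : ((1 - 4 * E ^ 2 : ℝ) : ℂ) * ψ 0 = 0 := by
      push_cast
      linear_combination 2 * e1 + 2 * E * h1
    exact_mod_cast (mul_eq_zero.1 this).resolve_right h0
  have hE3 : E = -(1 / 2) := by nlinarith
  have h2 : ψ 1 = -ψ 0 := by rw [h1, hE3]; push_cast; ring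
  have h3 : ψ 0 * (starRingEnd ℂ) (ψ 0) = 1 / 2 := by
    rw [h2, map_neg] at hn
    linear_combination hn / 2
  ext i j
  fin_cases i <;> fin_cases j <;> simp [Matrix.vecMulVec_apply, h2, h3]

end Bloch

/-! ### Optimal pairs -/

section Optimal

variable {T : ℝ} {s : ℝ → ℝ} {ρ : ℝ → Matrix (Fin 2) (Fin 2) ℂ}
  {ρ₀ : Matrix (Fin 2) (Fin 2) ℂ}

lemma IsGroundState.pauliCoeff_eq (h : IsGroundState driver ρ₀) : pauliCoeff ρ₀ = ![-1, 0, 0] := by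
  rw [h.driver_eq]
  ext k
  fin_cases k <;> norm_num [pauliCoeff]

lemma isAdmissible_bangBang (T : ℝ) : IsAdmissible T (bangBang T) := by
  refine ⟨?_, fun t _ => ?_⟩
  · exact (Measurable.ite measurableSet_Iio measurable_const measurable_const).aemeasurable
  · unfold bangBang
    split_ifs <;> simp

lemma SolvesVonNeumann.le_expect (h : SolvesVonNeumann driver target T s ρ) (hT : 0 ≤ T)
    (hTπ : T < Real.pi) (hs : IsAdmissible T s) (hρ : IsGroundState driver (ρ 0)) :
    Real.cos (T / 2) ^ 2 - 1 ≤ expect sigma3 (ρ T) := by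
  rw [expect_sigma3]
  refine (h.isBloch_re hT hs).le_final_height hT hTπ hs ?_ ?_ ?_ <;> simp [hρ.pauliCoeff_eq]

lemma SolvesVonNeumann.expect_bangBang (h : SolvesVonNeumann driver target T (bangBang T) ρ)
    (hT : 0 ≤ T) (hρ : IsGroundState driver (ρ 0)) :
    expect sigma3 (ρ T) = Real.cos (T / 2) ^ 2 - 1 := by
  have hs := isAdmissible_bangBang T
  rw [expect_sigma3]
  refine (h.isBloch_re hT hs).final_height_bangBang hT hs ?_ ?_ ?_ (.of_forall fun _ => rfl) <;>
  simp [hρ.pauliCoeff_eq]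

lemma exists_isOptimalPair_bangBang (hT : 0 ≤ T) (hTπ : T < Real.pi)
    (hρ₀ : IsGroundState driver ρ₀) :
    ∃ ρ, IsOptimalPair driver target sigma3 ρ₀ T (bangBang T) ρ := by
  obtain ⟨ρ, hρ, h0⟩ := exists_solvesVonNeumann driver target hT (isAdmissible_bangBang T) ρ₀
  refine ⟨ρ, ⟨isAdmissible_bangBang T, hρ, h0⟩, fun s' ρ' hs' hρ' h0' => ?_⟩
  rw [hρ.expect_bangBang hT (h0 ▸ hρ₀)]
  exact hρ'.le_expect hT hTπ hs' (h0' ▸ hρ₀)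

lemma IsOptimalPair.expect_le (h : IsOptimalPair driver target sigma3 ρ₀ T s ρ) (hT : 0 ≤ T)
    (hρ₀ : IsGroundState driver ρ₀) :
    expect sigma3 (ρ T) ≤ Real.cos (T / 2) ^ 2 - 1 := by
  obtain ⟨ρ', hρ', h0'⟩ := exists_solvesVonNeumann driver target hT (isAdmissible_bangBang T) ρ₀
  rw [← hρ'.expect_bangBang hT (h0' ▸ hρ₀)]
  exact h.2 _ _ (isAdmissible_bangBang T) hρ' h0'

lemma IsOptimalPair.ae_eq_bangBang (h : IsOptimalPair driver target sigma3 ρ₀ T s ρ) (hT : 0 ≤ T)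
    (hTπ : T < Real.pi) (hρ₀ : IsGroundState driver ρ₀) :
    ∀ᵐ t ∂volume.restrict (Icc 0 T), s t = bangBang T t := by
  have hle := h.expect_le hT hρ₀
  obtain ⟨⟨hs, hρ, h0⟩, -⟩ := h
  rw [expect_sigma3] at hle
  refine (hρ.isBloch_re hT hs).eq_bangBang hT hTπ hs ?_ ?_ ?_ hle <;>
  simp [h0, hρ₀.pauliCoeff_eq]

/-- On a singular arc the cross product of the Bloch vectors of state and co-state has equal first
and third components, which forces it to vanish up to the final time. -/
lemma IsOptimalPair.not_isSingularArc (h : IsOptimalPair driver target sigma3 ρ₀ T s ρ)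
    (hT : 0 < T) (hTπ : T < Real.pi) (hρ₀ : IsGroundState driver ρ₀)
    {p : ℝ → Matrix (Fin 2) (Fin 2) ℂ} (hp : IsCostate driver target sigma3 T s p) {a b : ℝ}
    (ha : 0 ≤ a) (hab : a < b) (hb : b ≤ T) : ¬ IsSingularArc driver target p ρ a b := by
  intro hsing
  have hbang := h.ae_eq_bangBang hT.le hTπ hρ₀
  have hle := h.expect_le hT.le hρ₀
  obtain ⟨⟨hs, hρ, h0⟩, -⟩ := h
  have hge := hρ.le_expect hT.le hTπ hs (h0 ▸ hρ₀)
  have hTT : T ∈ Icc 0 T := ⟨hT.le, le_rfl⟩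
  have hr := hρ.isBloch_re hT.le hs
  have hm := hr.cross (hp.1.isBloch_re hT.le hs)
  -- The state is Hermitian: the Bloch vector of its anti-Hermitian part starts at zero.
  have him : ∀ t ∈ Icc 0 T, ∀ k, (pauliCoeff (ρ t) k).im = 0 := by
    intro t ht
    have := (hρ.isBloch_im hT.le hs).normSq_eq hT.le ht
    simp only [h0, hρ₀.pauliCoeff_eq] at this
    simp at this
    have hk : (pauliCoeff (ρ t) 0).im = 0 ∧ (pauliCoeff (ρ t) 1).im = 0 ∧
        (pauliCoeff (ρ t) 2).im = 0 := by
      refine ⟨?_, ?_, ?_⟩ <;> rw [← sq_eq_zero_iff] <;>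
      nlinarith [sq_nonneg (pauliCoeff (ρ t) 0).im, sq_nonneg (pauliCoeff (ρ t) 1).im,
        sq_nonneg (pauliCoeff (ρ t) 2).im]
    intro k
    fin_cases k
    exacts [hk.1, hk.2.1, hk.2.2]
  have hzero := hm.eq_zero_of_singular hT.le hbang ha hab hb (fun t ht => by
    have e1 := controlHamiltonian_slope (p t) (ρ t)
      (him t ⟨ha.trans ht.1.le, ht.2.le.trans hb⟩)
    have e2 := hsing t ht 1 (by simp) 0 (by simp)
    linarith) T hTT
  -- At the final time `r × p = 0` with `p` vertical, so `r` is a unit vertical vector, whereas its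
  -- height is `cos² (T / 2) - 1`, strictly between `-1` and `0`.
  have hpT : pauliCoeff (p T) = ![0, 0, -2] := by
    rw [hp.2]
    ext k
    fin_cases k <;> norm_num [pauliCoeff, sigma3]
  simp [hpT] at hzero
  have hnorm := hr.normSq_eq hT.le hTT
  simp [h0, hρ₀.pauliCoeff_eq, hzero.1, hzero.2] at hnorm
  have hcos : 0 < Real.cos (T / 2) :=
    Real.cos_pos_of_mem_Ioo ⟨by linarith [Real.pi_pos], by linarith⟩
  have hcos1 : Real.cos (T / 2) < 1 := by
    have := Real.cos_lt_cos_of_nonneg_of_le_pi le_rfl (by linarith : T / 2 ≤ Real.pi)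
      (by linarith : (0 : ℝ) < T / 2)
    rwa [Real.cos_zero] at this
  rw [expect_sigma3] at hle hge
  rcases hnorm with hnorm | hnorm <;> nlinarith

end Optimal

end SpinControl

theorem theorem4 (tf : ℝ) (htf : 0 < tf) (htf_lt : tf < Real.pi)
    (ρ₀ : Matrix (Fin 2) (Fin 2) ℂ)
    (hρ₀ : SpinControl.IsGroundState SpinControl.driver ρ₀) :
    (∃ ρ : ℝ → Matrix (Fin 2) (Fin 2) ℂ,
      SpinControl.IsOptimalPair SpinControl.driver SpinControl.target SpinControl.sigma3 ρ₀ tf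
        (SpinControl.bangBang tf) ρ) ∧
    ∀ (s : ℝ → ℝ) (ρ : ℝ → Matrix (Fin 2) (Fin 2) ℂ),
      SpinControl.IsOptimalPair SpinControl.driver SpinControl.target SpinControl.sigma3 ρ₀ tf
        s ρ →
      (∀ᵐ t ∂(volume.restrict (Icc 0 tf)), s t = SpinControl.bangBang tf t) ∧
      (∃ p : ℝ → Matrix (Fin 2) (Fin 2) ℂ,
        SpinControl.IsCostate SpinControl.driver SpinControl.target SpinControl.sigma3 tf s p) ∧
      ∀ p : ℝ → Matrix (Fin 2) (Fin 2) ℂ,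
        SpinControl.IsCostate SpinControl.driver SpinControl.target SpinControl.sigma3 tf s p →
        ∀ a b : ℝ, 0 ≤ a → a < b → b ≤ tf →
          ¬ SpinControl.IsSingularArc SpinControl.driver SpinControl.target p ρ a b :=
  ⟨SpinControl.exists_isOptimalPair_bangBang htf.le htf_lt hρ₀, fun _ _ h =>
    ⟨h.ae_eq_bangBang htf.le htf_lt hρ₀,
      SpinControl.exists_isCostate _ _ _ htf.le h.1.1,
      fun _ hp _ _ ha hab hb => h.not_isSingularArc htf htf_lt hρ₀ hp ha hab hb⟩⟩
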